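/- There exists a constant $K<\infty$ such that the following holds for every integer $n\ge 1$. Let $Q=(Q_{ij})_{1\le i,j\le n}$ be a GOE random matrix, i.e. a random real symmetric matrix whose diagonal entries are $N(0,1)$ and whose off-diagonal entries are $N(0,1/2)$ (variance $1/2$), with $(Q_{ij})_{1\le i\le j\le n}$ mutually independent. Consider the standard quadratic program (StQP) $$\mu(Q)=\min\Bigl\{x^\top Qx:\ x\in\mathbb R^n,\ x\ge 0,\ \sum_{i}x_i=1\Bigr\}$$ and its doubly nonnegative (DNN) relaxation $$\vartheta(Q)=\min\Bigl\{\sum_{i,j}Q_{ij}X_{ij}:\ \sum_{i,j}X_{ij}=1,\ X\succeq 0,\ X_{ij}\ge 0\ \text{for all } i,j\Bigr\},$$ where $X$ ranges over real symmetric $n\times n$ matrices and $X\succeq0$ means positive semidefinite. Then $$\mathbb P\bigl(\text{the DNN relaxation has a unique optimizer, and it has rank one}\bigr)\ \ge\ 1-K\,\frac{(\ln n)^2}{n^3}.$$ Consequently, on the same event, and hence with at least the same probability, the DNN relaxation is exact, i.e. $\vartheta(Q)=\mu(Q)$, and the StQP has a unique optimizer. -/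

import Mathlib

open MeasureTheory ProbabilityTheory
open scoped NNReal Matrix

noncomputable section

namespace StQP

/-- The Frobenius (trace) inner product `⟨Z, Y⟩ = ∑ i j, Z i j * Y i j` of real matrices. -/
def frob {n : ℕ} (Z Y : Matrix (Fin n) (Fin n) ℝ) : ℝ :=
  ∑ i, ∑ j, Z i j * Y i j

/-- The all-ones matrix. -/
def allOnes (n : ℕ) : Matrix (Fin n) (Fin n) ℝ :=
  Matrix.of fun _ _ => 1

/-- The feasible set of the doubly nonnegative (DNN) relaxation:
positive semidefinite, entrywise nonnegative matrices `Y` with `⟨E, Y⟩ = 1`. -/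
def dnnFeasible (n : ℕ) : Set (Matrix (Fin n) (Fin n) ℝ) :=
  {Y | frob (allOnes n) Y = 1 ∧ Y.PosSemidef ∧ ∀ i j, 0 ≤ Y i j}

/-- The value of the DNN relaxation, `ϑ(Z) = min {⟨Z, Y⟩ : Y feasible}`. -/
def dnnValue {n : ℕ} (Z : Matrix (Fin n) (Fin n) ℝ) : ℝ :=
  sInf (frob Z '' dnnFeasible n)

/-- `Y` is an optimizer (a global minimizer) of the DNN relaxation. -/
def IsDNNOptimizer {n : ℕ} (Z Y : Matrix (Fin n) (Fin n) ℝ) : Prop :=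
  Y ∈ dnnFeasible n ∧ IsMinOn (frob Z) (dnnFeasible n) Y

/-- The objective `xᵀ Z x` of the standard quadratic program. -/
def quadForm {n : ℕ} (Z : Matrix (Fin n) (Fin n) ℝ) (x : Fin n → ℝ) : ℝ :=
  x ⬝ᵥ (Z *ᵥ x)

/-- The value of the standard quadratic program, `μ(Z) = min {xᵀ Z x : x in the simplex}`. -/
def stqpValue {n : ℕ} (Z : Matrix (Fin n) (Fin n) ℝ) : ℝ :=
  sInf (quadForm Z '' stdSimplex ℝ (Fin n))

/-- `x` is an optimizer (a global minimizer) of the standard quadratic program. -/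
def IsStQPOptimizer {n : ℕ} (Z : Matrix (Fin n) (Fin n) ℝ) (x : Fin n → ℝ) : Prop :=
  x ∈ stdSimplex ℝ (Fin n) ∧ IsMinOn (quadForm Z) (stdSimplex ℝ (Fin n)) x

/-- The DNN relaxation has exactly one optimizer, and that optimizer has rank one. -/
def DNNUniqueRankOne {n : ℕ} (Z : Matrix (Fin n) (Fin n) ℝ) : Prop :=
  ∃ Y, IsDNNOptimizer Z Y ∧ Y.rank = 1 ∧ ∀ Y', IsDNNOptimizer Z Y' → Y' = Y

/-- The DNN relaxation is exact: its value is the value of the standard quadratic program. -/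
def DNNExact {n : ℕ} (Z : Matrix (Fin n) (Fin n) ℝ) : Prop :=
  dnnValue Z = stqpValue Z

/-- `Q` is a GOE random matrix: (almost surely) symmetric, with diagonal entries `N(0, 1)`,
off-diagonal entries `N(0, 1/2)`, and the entries on and above the diagonal
mutually independent. -/
structure IsGOE {Ω : Type*} [MeasurableSpace Ω] (P : Measure Ω) {n : ℕ}
    (Q : Ω → Matrix (Fin n) (Fin n) ℝ) : Prop where
  symm : ∀ᵐ ω ∂P, (Q ω).IsSymm
  diag : ∀ i, HasLaw (fun ω => Q ω i i) (gaussianReal 0 1) P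
  offDiag : ∀ i j, i < j → HasLaw (fun ω => Q ω i j) (gaussianReal 0 (1 / 2)) P
  indep : iIndepFun (fun (p : {p : Fin n × Fin n // p.1 ≤ p.2}) ω => Q ω p.1.1 p.1.2) P

end StQP

end

/-!
Let `X` be an optimizer of the doubly nonnegative relaxation, assumed unique. Then `X` spans an
extreme ray of the doubly nonnegative cone: if `X` splits as a sum of two members of the cone,
both summands are proportional to `X` (`eq_smul_of_add_eq`). Call a pair `a, b` *light* if the
entry `Z a b` is smaller than every diagonal entry. The optimal value is at most every diagonal
entry, so across a set that no light pair leaves, dropping the cross entries of `X` costs nothing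
after subtracting the optimal value from the data; by uniqueness `X` lives on a single component
of the graph of light pairs (`eq_blockRestrict_of_closed`). If that component has at most four
vertices, `X` has rank one (`exists_eq_smul_vecMulVec_of_card_le_four`). This is the classical fact
that doubly nonnegative matrices of order at most four are completely positive, obtained by
splitting off rank-one pieces `y yᵀ` with `y` a nonnegative vector in the range of `X`. A rank-one
optimizer gives exactness and the unique optimizer of the quadratic program at once.

It remains to bound two probabilities. The optimizer is almost surely unique
(`IsGOE.ae_unique`): the optimal value is a Lipschitz function of the data, its derivative wherever
it exists is given by any optimizer, and Rademacher's theorem provides it almost everywhere.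
A component with at least five vertices contains a tree of four light pairs on five vertices.
There are `O(n⁵)` such trees, and each of them is light with probability `O((log n)² / n⁸)`
(`IsGOE.exists_light_bound`). The reason for the latter is that the tail of `N(0, 1/2)` beyond `-t`
is at most of order `t` times the square of the tail of `N(0, 1)` (`exists_gaussian_half_le_sq`),
while the minimum of the `n` diagonal entries sits at a level where the latter tail is of order
`1 / n`, that is, `t` is of order `√(log n)`. The fourth power of `t / n²` is the claimed bound.
-/

namespace StQP

/-! ### The doubly nonnegative cone -/

/-- The cone of doubly nonnegative matrices: `dnnFeasible` without the normalization. -/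
def IsDNN {n : ℕ} (Y : Matrix (Fin n) (Fin n) ℝ) : Prop :=
  Y.PosSemidef ∧ ∀ i j, 0 ≤ Y i j

section Cone

variable {n : ℕ}

lemma frob_add (Z Y Y' : Matrix (Fin n) (Fin n) ℝ) : frob Z (Y + Y') = frob Z Y + frob Z Y' := by
  simp [frob, mul_add, Finset.sum_add_distrib]

lemma frob_smul (Z Y : Matrix (Fin n) (Fin n) ℝ) (c : ℝ) : frob Z (c • Y) = c * frob Z Y := by
  simp only [frob, Matrix.smul_apply, smul_eq_mul, Finset.mul_sum]
  exact Finset.sum_congr rfl fun i _ => Finset.sum_congr rfl fun j _ => by ring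

lemma frob_allOnes (Y : Matrix (Fin n) (Fin n) ℝ) : frob (allOnes n) Y = ∑ i, ∑ j, Y i j := by
  simp [frob, allOnes]

lemma frob_vecMulVec (Z : Matrix (Fin n) (Fin n) ℝ) (x : Fin n → ℝ) :
    frob Z (Matrix.vecMulVec x x) = quadForm Z x := by
  simp only [frob, quadForm, Matrix.vecMulVec_apply, dotProduct, Matrix.mulVec, Finset.mul_sum]
  exact Finset.sum_congr rfl fun i _ => Finset.sum_congr rfl fun j _ => by ring

lemma frob_allOnes_vecMulVec (x : Fin n → ℝ) :
    frob (allOnes n) (Matrix.vecMulVec x x) = (∑ i, x i) ^ 2 := by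
  simp [frob_allOnes, Matrix.vecMulVec_apply, sq, Finset.sum_mul_sum]

lemma isDNN_vecMulVec {x : Fin n → ℝ} (hx : ∀ i, 0 ≤ x i) : IsDNN (Matrix.vecMulVec x x) :=
  ⟨by simpa using Matrix.posSemidef_vecMulVec_self_star x,
    fun i j => mul_nonneg (hx i) (hx j)⟩

lemma vecMulVec_mem_dnnFeasible {x : Fin n → ℝ} (hx : x ∈ stdSimplex ℝ (Fin n)) :
    Matrix.vecMulVec x x ∈ dnnFeasible n :=
  ⟨by rw [frob_allOnes_vecMulVec, hx.2, one_pow], isDNN_vecMulVec hx.1⟩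

lemma IsDNN.smul {Y : Matrix (Fin n) (Fin n) ℝ} (hY : IsDNN Y) {c : ℝ} (hc : 0 ≤ c) :
    IsDNN (c • Y) :=
  ⟨hY.1.smul hc, fun i j => mul_nonneg hc (hY.2 i j)⟩

lemma IsDNN.symm_apply {Y : Matrix (Fin n) (Fin n) ℝ} (hY : IsDNN Y) (i j : Fin n) :
    Y i j = Y j i := by
  simpa using (hY.1.isHermitian.apply i j).symm

lemma IsDNN.frob_allOnes_nonneg {Y : Matrix (Fin n) (Fin n) ℝ} (hY : IsDNN Y) :
    0 ≤ frob (allOnes n) Y := by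
  rw [frob_allOnes]
  exact Finset.sum_nonneg fun i _ => Finset.sum_nonneg fun j _ => hY.2 i j

lemma IsDNN.eq_zero {Y : Matrix (Fin n) (Fin n) ℝ} (hY : IsDNN Y)
    (h : frob (allOnes n) Y = 0) : Y = 0 := by
  rw [frob_allOnes, Finset.sum_eq_zero_iff_of_nonneg
    (fun i _ => Finset.sum_nonneg fun j _ => hY.2 i j)] at h
  ext i j
  exact (Finset.sum_eq_zero_iff_of_nonneg (fun j _ => hY.2 i j)).1 (h i (Finset.mem_univ _)) j
    (Finset.mem_univ _)

/-- Cauchy--Schwarz for the semi-inner product of a positive semidefinite matrix. -/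
lemma sq_dotProduct_mulVec_le {X : Matrix (Fin n) (Fin n) ℝ} (hX : X.PosSemidef)
    (v z : Fin n → ℝ) : (v ⬝ᵥ (X *ᵥ z)) ^ 2 ≤ (v ⬝ᵥ (X *ᵥ v)) * (z ⬝ᵥ (X *ᵥ z)) := by
  have hsymm : z ⬝ᵥ (X *ᵥ v) = v ⬝ᵥ (X *ᵥ z) := by
    rw [Matrix.dotProduct_mulVec, ← Matrix.mulVec_transpose, dotProduct_comm]
    congr 2
    simpa using hX.isHermitian.eq
  have key : ∀ t : ℝ, 0 ≤ (z ⬝ᵥ (X *ᵥ z)) * (t * t) + 2 * (v ⬝ᵥ (X *ᵥ z)) * t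
      + v ⬝ᵥ (X *ᵥ v) := by
    intro t
    have := hX.dotProduct_mulVec_nonneg (v + t • z)
    simp only [star_trivial, Matrix.mulVec_add, Matrix.mulVec_smul, add_dotProduct,
      dotProduct_add, smul_dotProduct, dotProduct_smul, smul_eq_mul, hsymm] at this
    linarith
  have := discrim_le_zero key
  rw [discrim] at this
  nlinarith

/-- If `X` is the only optimizer, then subtracting its value as a multiple of the all-ones matrix
gives an objective that is nonnegative on the whole cone and vanishes only on the ray of `X`. -/
lemma eq_smul_of_unique {Z X : Matrix (Fin n) (Fin n) ℝ} (hX : IsDNNOptimizer Z X)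
    (hu : ∀ X', IsDNNOptimizer Z X' → X' = X) {Y : Matrix (Fin n) (Fin n) ℝ} (hY : IsDNN Y)
    (hle : frob Z Y ≤ frob Z X * frob (allOnes n) Y) : Y = frob (allOnes n) Y • X := by
  rcases hY.frob_allOnes_nonneg.eq_or_lt with h0 | hpos
  · rw [← h0, zero_smul, hY.eq_zero h0.symm]
  set s := frob (allOnes n) Y
  have hmem : s⁻¹ • Y ∈ dnnFeasible n :=
    ⟨by rw [frob_smul]; exact inv_mul_cancel₀ hpos.ne', hY.smul (inv_nonneg.2 hpos.le)⟩
  have hval : frob Z (s⁻¹ • Y) ≤ frob Z X := by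
    rw [frob_smul, inv_mul_le_iff₀ hpos, mul_comm]
    exact hle
  have := hu (s⁻¹ • Y) ⟨hmem, fun W hW => hval.trans (hX.2 hW)⟩
  rw [← this, smul_smul, mul_inv_cancel₀ hpos.ne', one_smul]

lemma le_frob_of_isDNN {Z X : Matrix (Fin n) (Fin n) ℝ} (hX : IsDNNOptimizer Z X)
    {Y : Matrix (Fin n) (Fin n) ℝ} (hY : IsDNN Y) :
    frob Z X * frob (allOnes n) Y ≤ frob Z Y := by
  rcases hY.frob_allOnes_nonneg.eq_or_lt with h0 | hpos
  · rw [← h0, hY.eq_zero h0.symm]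
    simp [frob]
  set s := frob (allOnes n) Y
  have hmem : s⁻¹ • Y ∈ dnnFeasible n :=
    ⟨by rw [frob_smul]; exact inv_mul_cancel₀ hpos.ne', hY.smul (inv_nonneg.2 hpos.le)⟩
  have : frob Z X ≤ frob Z (s⁻¹ • Y) := hX.2 hmem
  rw [frob_smul, inv_mul_eq_div, le_div_iff₀ hpos] at this
  exact this

/-- A unique optimizer spans an extreme ray of the cone. -/
lemma eq_smul_of_add_eq {Z X : Matrix (Fin n) (Fin n) ℝ} (hX : IsDNNOptimizer Z X)
    (hu : ∀ X', IsDNNOptimizer Z X' → X' = X) {Y Y' : Matrix (Fin n) (Fin n) ℝ}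
    (hY : IsDNN Y) (hY' : IsDNN Y') (h : Y + Y' = X) : Y = frob (allOnes n) Y • X := by
  refine eq_smul_of_unique hX hu hY ?_
  have h1 := le_frob_of_isDNN hX hY'
  have h2 := frob_add Z Y Y'
  have h3 := frob_add (allOnes n) Y Y'
  rw [h] at h2 h3
  rw [hX.1.1] at h3
  have : frob (allOnes n) Y' = 1 - frob (allOnes n) Y := by linarith
  rw [this] at h1
  linarith

/-- A nonzero nonnegative vector `y` in the range of the unique optimizer `X`, whose support
is a clique of the positivity pattern of `X`, makes `X` a multiple of `y yᵀ`: a small multiple of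
`y yᵀ` can be split off from `X` inside the cone. -/
lemma exists_eq_smul_vecMulVec {Z X : Matrix (Fin n) (Fin n) ℝ} (hX : IsDNNOptimizer Z X)
    (hu : ∀ X', IsDNNOptimizer Z X' → X' = X) {z y : Fin n → ℝ} (hyz : y = X *ᵥ z)
    (hy : ∀ i, 0 ≤ y i) (hy0 : y ≠ 0) (hcl : ∀ j k, X j k = 0 → y j * y k = 0) :
    ∃ c : ℝ, X = c • Matrix.vecMulVec y y := by
  -- the size of the split-off piece is bounded by `zᵀ X z` and by the ratios of the entries
  obtain ⟨t, ht, htz, htX⟩ : ∃ t : ℝ, 0 < t ∧ t * (z ⬝ᵥ (X *ᵥ z)) ≤ 1 ∧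
      ∀ j k, t * (y j * y k) ≤ X j k := by
    have h1 : ∀ᶠ t : ℝ in nhdsWithin 0 (Set.Ioi 0), t * (z ⬝ᵥ (X *ᵥ z)) ≤ 1 := by
      have : Filter.Tendsto (fun t : ℝ => t * (z ⬝ᵥ (X *ᵥ z))) (nhdsWithin 0 (Set.Ioi 0))
          (nhds (0 * (z ⬝ᵥ (X *ᵥ z)))) :=
        ((continuous_id.mul continuous_const).tendsto 0).mono_left nhdsWithin_le_nhds
      rw [zero_mul] at this
      exact (this.eventually_lt_const one_pos).mono fun _ h => h.le
    have h2 : ∀ j k, ∀ᶠ t : ℝ in nhdsWithin 0 (Set.Ioi 0), t * (y j * y k) ≤ X j k := by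
      intro j k
      rcases (hX.1.2.2 j k).eq_or_lt with h0 | hpos
      · rw [hcl j k h0.symm, ← h0]
        simp
      · have : Filter.Tendsto (fun t : ℝ => t * (y j * y k)) (nhdsWithin 0 (Set.Ioi 0))
            (nhds (0 * (y j * y k))) :=
          ((continuous_id.mul continuous_const).tendsto 0).mono_left nhdsWithin_le_nhds
        rw [zero_mul] at this
        exact (this.eventually_lt_const hpos).mono fun _ h => h.le
    obtain ⟨t, ⟨ht1, ht2⟩, ht⟩ := ((h1.and (Filter.eventually_all.2 fun j =>
      Filter.eventually_all.2 fun k => h2 j k)).and self_mem_nhdsWithin).exists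
    exact ⟨t, ht, ht1, ht2⟩
  have hY := (isDNN_vecMulVec hy).smul ht.le
  have hY' : IsDNN (X - t • Matrix.vecMulVec y y) := by
    refine ⟨Matrix.PosSemidef.of_dotProduct_mulVec_nonneg
      (hX.1.2.1.isHermitian.sub hY.1.isHermitian) fun v => ?_, fun j k => ?_⟩
    · have hcs := sq_dotProduct_mulVec_le hX.1.2.1 v z
      rw [← hyz] at hcs
      have hv : v ⬝ᵥ (Matrix.vecMulVec y y *ᵥ v) = (v ⬝ᵥ y) ^ 2 := by
        rw [Matrix.vecMulVec_mulVec, dotProduct_smul, dotProduct_comm y v]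
        simp [sq]
      have hvX : 0 ≤ v ⬝ᵥ (X *ᵥ v) := by simpa using hX.1.2.1.dotProduct_mulVec_nonneg v
      simp only [star_trivial, Matrix.sub_mulVec, Matrix.smul_mulVec, dotProduct_sub,
        dotProduct_smul, hv, smul_eq_mul]
      rw [← hyz] at htz
      nlinarith [mul_le_mul_of_nonneg_left hcs ht.le]
    · have := htX j k
      simp only [Matrix.sub_apply, Matrix.smul_apply, Matrix.vecMulVec_apply, smul_eq_mul]
      linarith
  have heq := eq_smul_of_add_eq hX hu hY hY' (by abel)
  set s := frob (allOnes n) (t • Matrix.vecMulVec y y)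
  have hs : s ≠ 0 := by
    intro h0
    rw [h0, zero_smul] at heq
    obtain ⟨i, hi⟩ := Function.ne_iff.1 hy0
    have := congrFun (congrFun heq i) i
    simp only [Matrix.smul_apply, Matrix.vecMulVec_apply, smul_eq_mul, Matrix.zero_apply,
      mul_eq_zero, or_self] at this
    exact this.elim ht.ne' hi
  refine ⟨s⁻¹ * t, ?_⟩
  rw [← smul_smul, heq, smul_smul, inv_mul_cancel₀ hs, one_smul]

end Cone

/-! ### Localization of the optimizer and the four-by-four case -/

section Localization

variable {n : ℕ}

/-- The matrix obtained from `X` by setting to zero all entries outside `C × C`. -/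
def blockRestrict (C : Finset (Fin n)) (X : Matrix (Fin n) (Fin n) ℝ) :
    Matrix (Fin n) (Fin n) ℝ :=
  Matrix.of fun i j => if i ∈ C ∧ j ∈ C then X i j else 0

lemma blockRestrict_apply (C : Finset (Fin n)) (X : Matrix (Fin n) (Fin n) ℝ) (i j : Fin n) :
    blockRestrict C X i j = if i ∈ C ∧ j ∈ C then X i j else 0 := rfl

lemma IsDNN.blockRestrict {X : Matrix (Fin n) (Fin n) ℝ} (hX : IsDNN X) (C : Finset (Fin n)) :
    IsDNN (blockRestrict C X) := by
  constructor
  · have h := hX.1.mul_mul_conjTranspose_same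
      (Matrix.diagonal fun i => if i ∈ C then (1 : ℝ) else 0)
    convert h using 1
    ext i j
    rw [Matrix.diagonal_conjTranspose, Matrix.mul_diagonal, Matrix.diagonal_mul,
      blockRestrict_apply]
    by_cases hi : i ∈ C <;> by_cases hj : j ∈ C <;> simp [hi, hj]
  · intro i j
    rw [blockRestrict_apply]
    split_ifs
    exacts [hX.2 i j, le_rfl]

/-- If the entries of `Z` between `C` and its complement are at least the optimal value,
then a unique optimizer that charges `C` lives on `C`. -/
lemma eq_blockRestrict_of_closed {Z X : Matrix (Fin n) (Fin n) ℝ} (hX : IsDNNOptimizer Z X)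
    (hu : ∀ X', IsDNNOptimizer Z X' → X' = X) {C : Finset (Fin n)} {i : Fin n} (hi : i ∈ C)
    (hii : 0 < X i i)
    (hC : ∀ a ∈ C, ∀ b ∉ C, frob Z X ≤ Z a b ∧ frob Z X ≤ Z b a) :
    blockRestrict C X = X := by
  set θ := frob Z X with hθ
  set X₁ := blockRestrict C X with hX₁
  set X₂ := blockRestrict Cᶜ X with hX₂
  set X₃ := X - X₁ - X₂ with hX₃
  have hsum : X = X₁ + (X₂ + X₃) := by rw [hX₃]; abel
  have h1 : IsDNN X₁ := IsDNN.blockRestrict hX.1.2 C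
  have h2 : IsDNN X₂ := IsDNN.blockRestrict hX.1.2 Cᶜ
  have h3 : θ * frob (allOnes n) X₃ ≤ frob Z X₃ := by
    rw [frob_allOnes]
    simp only [frob, Finset.mul_sum]
    refine Finset.sum_le_sum fun a _ => Finset.sum_le_sum fun b _ => ?_
    have hab := hX.1.2.2 a b
    simp only [hX₃, hX₁, hX₂, Matrix.sub_apply, blockRestrict_apply, Finset.mem_compl]
    by_cases ha : a ∈ C <;> by_cases hb : b ∈ C <;> simp only [ha, hb, not_true, not_false_iff,
      and_true, and_false, if_true, if_false, sub_self, sub_zero, mul_zero, le_refl]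
    · exact mul_le_mul_of_nonneg_right (hC a ha b hb).1 hab
    · exact mul_le_mul_of_nonneg_right (hC b hb a ha).2 hab
  have hZ := frob_add Z X₁ (X₂ + X₃)
  have hE := frob_add (allOnes n) X₁ (X₂ + X₃)
  rw [← hsum, frob_add] at hZ hE
  have hone : frob (allOnes n) X = 1 := hX.1.1
  have h4 := le_frob_of_isDNN hX h2
  rw [← hθ] at h4
  have hle : frob Z X₁ ≤ θ * frob (allOnes n) X₁ := by
    have : θ * (frob (allOnes n) X₁ + (frob (allOnes n) X₂ + frob (allOnes n) X₃)) = θ := by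
      rw [← hE, hone, mul_one]
    rw [← hθ] at hZ
    linarith
  have heq := eq_smul_of_unique hX hu h1 hle
  have hent := congrFun (congrFun heq i) i
  rw [hX₁, blockRestrict_apply, if_pos ⟨hi, hi⟩, ← hX₁, Matrix.smul_apply, smul_eq_mul] at hent
  have hs : frob (allOnes n) X₁ = 1 := by
    have := mul_right_cancel₀ hii.ne' ((one_mul _).trans hent)
    exact this.symm
  rw [heq, hs, one_smul]

lemma IsDNN.diag_pos {X : Matrix (Fin n) (Fin n) ℝ} (hX : IsDNN X) {i j : Fin n}
    (h : 0 < X i j) : 0 < X i i := by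
  have := sq_dotProduct_mulVec_le hX.1 (Pi.single i 1) (Pi.single j 1)
  simp only [single_dotProduct, Matrix.mulVec_single, MulOpposite.op_one, one_smul,
    Matrix.col_apply, one_mul] at this
  rcases (hX.2 i i).eq_or_lt with h0 | h0
  · rw [← h0, zero_mul] at this
    nlinarith
  · exact h0

lemma exists_diag_pos {X : Matrix (Fin n) (Fin n) ℝ} (hX : X ∈ dnnFeasible n) :
    ∃ i, 0 < X i i := by
  by_contra! h
  have hz : X = 0 := by
    ext i j
    by_contra hij
    exact (h i).not_gt (IsDNN.diag_pos hX.2 ((hX.2.2 i j).lt_of_ne' hij))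
  have h1 := hX.1
  rw [hz] at h1
  simp [frob] at h1

/-- The case of a doubly nonnegative matrix whose positivity pattern on its support is the
four-cycle `a b c d`. Eliminating `c` and `d` gives a vector in the range supported on the
edge `a b`. -/
lemma exists_range_vector_of_cycle {X : Matrix (Fin n) (Fin n) ℝ} (hX : IsDNN X)
    {a b c d : Fin n} (hac : X a c = 0) (hbd : X b d = 0)
    (hab : 0 < X a b) (hbc : 0 < X b c) (hcd : 0 < X c d) (had : 0 < X a d)
    (hsupp : ∀ j, j ≠ a → j ≠ b → j ≠ c → j ≠ d → ∀ k, X j k = 0) :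
    ∃ z y : Fin n → ℝ, y = X *ᵥ z ∧ (∀ i, 0 ≤ y i) ∧ y ≠ 0 ∧ ∀ j k, X j k = 0 → y j * y k = 0 := by
  have sa := hX.symm_apply
  have hca : X c a = 0 := by rw [sa, hac]
  have hdb : X d b = 0 := by rw [sa, hbd]
  have hba : 0 < X b a := by rw [sa]; exact hab
  have haa := hX.diag_pos hab
  have hbb := hX.diag_pos hba
  -- the block on `c, d` is nonsingular, as its kernel vector would be in the kernel of `X`
  have hdet : 0 < X c c * X d d - X c d ^ 2 := by
    have hcs := sq_dotProduct_mulVec_le hX.1 (Pi.single a 1)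
      (Pi.single c (X d d) + Pi.single d (-X c d))
    have hcs' := sq_dotProduct_mulVec_le hX.1 (Pi.single c 1) (Pi.single d 1)
    simp only [Matrix.mulVec_add, Matrix.mulVec_single, add_dotProduct, single_dotProduct,
      Pi.add_apply, Pi.smul_apply, Matrix.col_apply, MulOpposite.smul_eq_mul_unop,
      MulOpposite.unop_op, hac, zero_mul, one_mul, mul_one, zero_add, sa d c] at hcs hcs'
    rcases (sub_nonneg.2 hcs').eq_or_lt with h0 | h0
    · have : (X a d * X c d) ^ 2 ≤ X a a * (X d d * (X c c * X d d - X c d ^ 2)) := by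
        nlinarith [hcs]
      rw [← h0, mul_zero, mul_zero] at this
      have := mul_pos had hcd
      nlinarith
    · exact h0
  set δ := X c c * X d d - X c d ^ 2 with hδ
  set z : Fin n → ℝ := Pi.single a δ + Pi.single c (X a d * X c d) +
    Pi.single d (-(X a d * X c c)) with hz
  have hXz : ∀ j, (X *ᵥ z) j = X j a * δ + X j c * (X a d * X c d) - X j d * (X a d * X c c) := by
    intro j
    simp only [hz, Matrix.mulVec_add, Matrix.mulVec_single, Pi.add_apply, Pi.smul_apply,
      Matrix.col_apply, MulOpposite.smul_eq_mul_unop, MulOpposite.unop_op]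
    ring
  have hyc : (X *ᵥ z) c = 0 := by rw [hXz, hca]; ring
  have hyd : (X *ᵥ z) d = 0 := by rw [hXz, sa d a, sa d c, hδ]; ring
  have hyb : 0 < (X *ᵥ z) b := by
    rw [hXz, hbd]
    have := mul_pos hba hdet
    have := mul_pos hbc (mul_pos had hcd)
    linarith
  have hya : 0 ≤ (X *ᵥ z) a := by
    have h := hX.1.dotProduct_mulVec_nonneg z
    rw [star_trivial] at h
    conv at h => rhs; rw [hz]
    rw [add_dotProduct, add_dotProduct, single_dotProduct, single_dotProduct, single_dotProduct,
      ← hz, hyc, hyd, mul_zero, mul_zero, add_zero, add_zero] at h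
    exact nonneg_of_mul_nonneg_right h hdet
  have hyo : ∀ j, j ≠ a → j ≠ b → (X *ᵥ z) j = 0 := by
    intro j ja jb
    rcases eq_or_ne j c with rfl | jc
    · exact hyc
    rcases eq_or_ne j d with rfl | jd
    · exact hyd
    rw [hXz, hsupp j ja jb jc jd, hsupp j ja jb jc jd, hsupp j ja jb jc jd]
    ring
  refine ⟨z, _, rfl, fun j => ?_, fun h0 => hyb.ne' (congrFun h0 b), fun j k hjk => ?_⟩
  · by_cases ja : j = a
    · rw [ja]; exact hya
    by_cases jb : j = b
    · rw [jb]; exact hyb.le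
    exact (hyo j ja jb).ge
  · by_contra hne
    have hj : j = a ∨ j = b := by
      by_contra! h
      exact hne (by rw [hyo j h.1 h.2, zero_mul])
    have hk : k = a ∨ k = b := by
      by_contra! h
      exact hne (by rw [hyo k h.1 h.2, mul_zero])
    rcases hj with rfl | rfl <;> rcases hk with rfl | rfl
    exacts [haa.ne' hjk, hab.ne' hjk, hba.ne' hjk, hbb.ne' hjk]

/-- A unique optimizer supported on at most four indices has rank one. In the positivity graph
of a counterexample every vertex would have two nonadjacent neighbours, which on four vertices
leaves only the four-cycle. -/
lemma exists_eq_smul_vecMulVec_of_card_le_four {Z X : Matrix (Fin n) (Fin n) ℝ}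
    (hX : IsDNNOptimizer Z X) (hu : ∀ X', IsDNNOptimizer Z X' → X' = X) {C : Finset (Fin n)}
    (hC : C.card ≤ 4) (hXC : blockRestrict C X = X) :
    ∃ (c : ℝ) (y : Fin n → ℝ), (∀ i, 0 ≤ y i) ∧ X = c • Matrix.vecMulVec y y := by
  by_contra hcon
  have hD : IsDNN X := hX.1.2
  have sa := hD.symm_apply
  have hno : ∀ z y : Fin n → ℝ, y = X *ᵥ z → (∀ i, 0 ≤ y i) → y ≠ 0 →
      ¬ ∀ j k, X j k = 0 → y j * y k = 0 := by
    intro z y h1 h2 h3 h4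
    obtain ⟨c, hc⟩ := exists_eq_smul_vecMulVec hX hu h1 h2 h3 h4
    exact hcon ⟨c, y, h2, hc⟩
  have hmem : ∀ {j k}, 0 < X j k → j ∈ C := by
    intro j k hjk
    by_contra hj
    rw [← hXC, blockRestrict_apply, if_neg fun h => hj h.1] at hjk
    exact hjk.false
  have hnbr : ∀ i, 0 < X i i → ∃ j k, X j k = 0 ∧ 0 < X j i ∧ 0 < X k i := by
    intro i hi
    have := hno (Pi.single i 1) _ rfl (fun j => by simpa using hD.2 j i)
      (fun h => hi.ne' (by simpa using congrFun h i))
    push Not at this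
    obtain ⟨j, k, hjk, hne⟩ := this
    simp only [Matrix.mulVec_single, MulOpposite.op_one, one_smul, Matrix.col_apply,
      mul_ne_zero_iff] at hne
    exact ⟨j, k, hjk, (hD.2 j i).lt_of_ne' hne.1, (hD.2 k i).lt_of_ne' hne.2⟩
  obtain ⟨a, ha⟩ := exists_diag_pos hX.1
  obtain ⟨b, d, hbd, hba, hda⟩ := hnbr a ha
  have hbb := hD.diag_pos hba
  have hdd := hD.diag_pos hda
  -- the second neighbour of `b`, besides `a`
  obtain ⟨c, hac, hcb⟩ : ∃ c, X a c = 0 ∧ 0 < X c b := by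
    obtain ⟨j, k, hjk, hj, hk⟩ := hnbr b hbb
    by_contra! hno'
    have hja : j ≠ a := fun h => (hno' k (by rw [← h]; exact hjk)).not_gt hk
    have hka : k ≠ a := fun h => (hno' j (by rw [← h, sa]; exact hjk)).not_gt hj
    have : ({a, b, d, j, k} : Finset (Fin n)) ⊆ C := by
      intro x hx
      simp only [Finset.mem_insert, Finset.mem_singleton] at hx
      rcases hx with rfl | rfl | rfl | rfl | rfl
      exacts [hmem ha, hmem hba, hmem hda, hmem hj, hmem hk]
    have hcard := (Finset.card_le_card this).trans hC
    have h1 : a ≠ b := by rintro rfl; rw [sa, hbd] at hda; exact hda.false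
    have h2 : a ≠ d := by rintro rfl; rw [hbd] at hba; exact hba.false
    have h3 : b ≠ d := by rintro rfl; exact hbb.ne' hbd
    have h4 : b ≠ j := by rintro rfl; rw [sa, hjk] at hk; exact hk.false
    have h5 : b ≠ k := by rintro rfl; rw [hjk] at hj; exact hj.false
    have h6 : d ≠ j := by rintro rfl; rw [sa, hbd] at hj; exact hj.false
    have h7 : d ≠ k := by rintro rfl; rw [sa, hbd] at hk; exact hk.false
    have h8 : j ≠ k := by rintro rfl; exact (hD.diag_pos hj).ne' hjk
    rw [Finset.card_insert_of_notMem (by simp [h1, h2, hja.symm, hka.symm]),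
      Finset.card_insert_of_notMem (by simp [h3, h4, h5]),
      Finset.card_insert_of_notMem (by simp [h6, h7]),
      Finset.card_insert_of_notMem (by simp [h8]), Finset.card_singleton] at hcard
    omega
  have hcc := hD.diag_pos hcb
  have h1 : a ≠ b := by rintro rfl; rw [sa, hbd] at hda; exact hda.false
  have h2 : a ≠ d := by rintro rfl; rw [hbd] at hba; exact hba.false
  have h3 : b ≠ d := by rintro rfl; exact hbb.ne' hbd
  have h4 : a ≠ c := by rintro rfl; exact ha.ne' hac
  have h5 : b ≠ c := by rintro rfl; rw [sa, hac] at hba; exact hba.false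
  have h6 : c ≠ d := by rintro rfl; rw [sa, hbd] at hcb; exact hcb.false
  have hCeq : ({a, b, c, d} : Finset (Fin n)) = C := by
    apply Finset.eq_of_subset_of_card_le
    · intro x hx
      simp only [Finset.mem_insert, Finset.mem_singleton] at hx
      rcases hx with rfl | rfl | rfl | rfl
      exacts [hmem ha, hmem hba, hmem hcb, hmem hda]
    · rw [Finset.card_insert_of_notMem (by simp [h1, h4, h2]),
        Finset.card_insert_of_notMem (by simp [h5, h3]),
        Finset.card_insert_of_notMem (by simp [h6]), Finset.card_singleton]
      exact hC
  have hmem' : ∀ {j k}, 0 < X j k → j = a ∨ j = b ∨ j = c ∨ j = d := by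
    intro j k hjk
    have := hmem hjk
    rw [← hCeq] at this
    simpa using this
  have hcd : 0 < X c d := by
    obtain ⟨j, k, hjk, hj, hk⟩ := hnbr d hdd
    have h8 : j ≠ k := by rintro rfl; exact (hD.diag_pos hj).ne' hjk
    have hj' : j = a ∨ j = c := by
      rcases hmem' hj with rfl | rfl | rfl | rfl
      · exact Or.inl rfl
      · exact absurd hbd hj.ne'
      · exact Or.inr rfl
      · rw [sa, hjk] at hk; exact absurd hk (lt_irrefl _)
    have hk' : k = a ∨ k = c := by
      rcases hmem' hk with rfl | rfl | rfl | rfl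
      · exact Or.inl rfl
      · exact absurd hbd hk.ne'
      · exact Or.inr rfl
      · rw [hjk] at hj; exact absurd hj (lt_irrefl _)
    rcases hj' with rfl | rfl
    · rcases hk' with rfl | rfl
      · exact absurd rfl h8
      · exact hk
    · exact hj
  obtain ⟨z, y, hyz, hy, hy0, hcl⟩ := exists_range_vector_of_cycle hD hac hbd
    (by rw [sa]; exact hba) (by rw [sa]; exact hcb) hcd (by rw [sa]; exact hda)
    (fun j ja jb jc jd k => by
      by_contra hjk
      rcases hmem' ((hD.2 j k).lt_of_ne' hjk) with h | h | h | h
      exacts [ja h, jb h, jc h, jd h])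
  exact hno z y hyz hy hy0 hcl

lemma IsDNNOptimizer.dnnValue_eq {Z X : Matrix (Fin n) (Fin n) ℝ} (hX : IsDNNOptimizer Z X) :
    dnnValue Z = frob Z X := by
  have h1 : IsLeast (frob Z '' dnnFeasible n) (frob Z X) := by
    refine ⟨⟨X, hX.1, rfl⟩, ?_⟩
    rintro _ ⟨Y, hY, rfl⟩
    exact hX.2 hY
  rw [dnnValue, h1.csInf_eq]

/-- A unique rank-one optimizer `x xᵀ` of the relaxation makes the relaxation exact and `x` the
only optimizer of the quadratic program. -/
lemma exact_of_eq_smul_vecMulVec {Z X : Matrix (Fin n) (Fin n) ℝ} (hX : IsDNNOptimizer Z X)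
    (hu : ∀ X', IsDNNOptimizer Z X' → X' = X) {c : ℝ} {y : Fin n → ℝ} (hy : ∀ i, 0 ≤ y i)
    (hXy : X = c • Matrix.vecMulVec y y) :
    DNNUniqueRankOne Z ∧ DNNExact Z ∧ ∃! x : Fin n → ℝ, IsStQPOptimizer Z x := by
  set s := ∑ i, y i with hs
  have hone : c * s ^ 2 = 1 := by
    rw [← frob_allOnes_vecMulVec, ← frob_smul, ← hXy]
    exact hX.1.1
  have hs0 : s ≠ 0 := by
    intro h
    rw [h] at hone
    norm_num at hone
  set x : Fin n → ℝ := fun i => s⁻¹ * y i with hx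
  have hxs : x ∈ stdSimplex ℝ (Fin n) := by
    refine ⟨fun i => mul_nonneg (inv_nonneg.2 (Finset.sum_nonneg fun i _ => hy i)) (hy i), ?_⟩
    rw [hx, ← Finset.mul_sum, inv_mul_cancel₀ hs0]
  have hXx : X = Matrix.vecMulVec x x := by
    rw [hXy]
    ext i j
    simp only [Matrix.smul_apply, Matrix.vecMulVec_apply, smul_eq_mul, hx]
    rw [eq_inv_of_mul_eq_one_left hone]
    ring
  have hmin : ∀ w ∈ stdSimplex ℝ (Fin n), frob Z X ≤ quadForm Z w := by
    intro w hw
    rw [← frob_vecMulVec]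
    exact hX.2 (vecMulVec_mem_dnnFeasible hw)
  have hval : quadForm Z x = frob Z X := by rw [hXx, frob_vecMulVec]
  refine ⟨⟨X, hX, ?_, hu⟩, ?_, x, ⟨hxs, fun w hw => ?_⟩, ?_⟩
  · apply le_antisymm
    · rw [hXx]
      exact Matrix.rank_vecMulVec_le x x
    · rw [Nat.one_le_iff_ne_zero]
      intro h0
      rw [Matrix.rank, Submodule.finrank_eq_zero, LinearMap.range_eq_bot] at h0
      have hz : X = 0 := by
        ext i j
        simpa using congrFun (LinearMap.congr_fun h0 (Pi.single j 1)) i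
      have := hX.1.1
      rw [hz] at this
      simp [frob] at this
  · have h2 : IsLeast (quadForm Z '' stdSimplex ℝ (Fin n)) (frob Z X) := by
      refine ⟨⟨x, hxs, hval⟩, ?_⟩
      rintro _ ⟨w, hw, rfl⟩
      exact hmin w hw
    rw [DNNExact, hX.dnnValue_eq, stqpValue, h2.csInf_eq]
  · change quadForm Z x ≤ quadForm Z w
    rw [hval]
    exact hmin w hw
  · intro w hw
    have hwx : Matrix.vecMulVec w w = X := by
      refine hu _ ⟨vecMulVec_mem_dnnFeasible hw.1, fun Y hY => ?_⟩
      change frob Z (Matrix.vecMulVec w w) ≤ frob Z Y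
      rw [frob_vecMulVec]
      have h1 : quadForm Z w ≤ quadForm Z x := hw.2 hxs
      rw [hval] at h1
      exact h1.trans (hX.2 hY)
    -- both vectors are the row sums of their common rank-one matrix
    funext i
    have h1 : ∑ j, Matrix.vecMulVec w w i j = ∑ j, Matrix.vecMulVec x x i j := by
      rw [hwx, hXx]
    simp only [Matrix.vecMulVec_apply, ← Finset.mul_sum] at h1
    rwa [hw.1.2, hxs.2, mul_one, mul_one] at h1

end Localization

/-! ### Small components of a relation -/

/-- Either `v₀` lies in a set of at most `m` points that no relation leaves, or there is a sequence
of `m + 1` distinct points each of which, after the first, is related to an earlier one. -/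
lemma exists_closed_or_growing {V : Type*} [DecidableEq V] (r : V → V → Prop) (v₀ : V) (m : ℕ) :
    (∃ C : Finset V, v₀ ∈ C ∧ C.card ≤ m ∧ ∀ a ∈ C, ∀ b ∉ C, ¬ r a b) ∨
    ∃ v : Fin (m + 1) → V, v.Injective ∧ v 0 = v₀ ∧
      ∀ k : Fin m, ∃ j : Fin (m + 1), j ≤ k.castSucc ∧ r (v j) (v k.succ) := by
  induction m with
  | zero =>
    exact Or.inr ⟨fun _ => v₀, fun a b _ => Fin.ext (by omega), rfl, fun k => k.elim0⟩
  | succ m ih =>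
    rcases ih with ⟨C, h1, h2, h3⟩ | ⟨v, hv, hv0, hr⟩
    · exact Or.inl ⟨C, h1, h2.trans (Nat.le_succ m), h3⟩
    by_cases hcl : ∀ a ∈ Finset.univ.image v, ∀ b ∉ Finset.univ.image v, ¬ r a b
    · refine Or.inl ⟨Finset.univ.image v, ?_, ?_, hcl⟩
      · exact Finset.mem_image.2 ⟨0, Finset.mem_univ _, hv0⟩
      · exact Finset.card_image_le.trans (by simp)
    · push Not at hcl
      obtain ⟨a, ha, b, hb, hab⟩ := hcl
      obtain ⟨j, -, rfl⟩ := Finset.mem_image.1 ha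
      refine Or.inr ⟨Fin.snoc v b, ?_, ?_, fun k => ?_⟩
      · rw [Fin.snoc_injective_iff]
        exact ⟨hv, fun ⟨i, hi⟩ => hb (Finset.mem_image.2 ⟨i, Finset.mem_univ _, hi⟩)⟩
      · rw [← Fin.castSucc_zero, Fin.snoc_castSucc (α := fun _ => V), hv0]
      · refine Fin.lastCases ?_ (fun k => ?_) k
        · refine ⟨j.castSucc, Fin.castSucc_le_castSucc_iff.2 (Fin.le_last j), ?_⟩
          rw [Fin.snoc_castSucc (α := fun _ => V), Fin.succ_last, Fin.snoc_last]
          exact hab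
        · obtain ⟨i, hik, hi⟩ := hr k
          refine ⟨i.castSucc, Fin.castSucc_le_castSucc_iff.2 hik, ?_⟩
          rw [Fin.snoc_castSucc (α := fun _ => V), Fin.succ_castSucc,
            Fin.snoc_castSucc (α := fun _ => V)]
          exact hi

/-- The pair `a, b` is light for `Z` if the entry `Z a b` is smaller than every diagonal entry. -/
def IsLight {n : ℕ} (Z : Matrix (Fin n) (Fin n) ℝ) (a b : Fin n) : Prop :=
  ∀ k, Z a b < Z k k

/-- Deterministic criterion: if the relaxation has a unique optimizer and every component of the
graph of light pairs has at most four vertices, then the optimizer has rank one. -/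
theorem exact_of_unique_of_no_growing {n : ℕ} {Z X : Matrix (Fin n) (Fin n) ℝ} (hZ : Z.IsSymm)
    (hX : IsDNNOptimizer Z X) (hu : ∀ X', IsDNNOptimizer Z X' → X' = X)
    (hgood : ¬ ∃ v : Fin 5 → Fin n, v.Injective ∧
      ∀ k : Fin 4, ∃ j : Fin 5, j ≤ k.castSucc ∧ IsLight Z (v j) (v k.succ)) :
    DNNUniqueRankOne Z ∧ DNNExact Z ∧ ∃! x : Fin n → ℝ, IsStQPOptimizer Z x := by
  obtain ⟨i, hi⟩ := exists_diag_pos hX.1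
  rcases exists_closed_or_growing (IsLight Z) i 4 with ⟨C, hiC, hC, hcl⟩ | ⟨v, hv, -, hr⟩
  · have hdiag : ∀ k, frob Z X ≤ Z k k := by
      intro k
      have : frob Z X ≤ frob Z (Matrix.vecMulVec (Pi.single k 1) (Pi.single k 1)) :=
        hX.2 (vecMulVec_mem_dnnFeasible (single_mem_stdSimplex ℝ k))
      rw [frob_vecMulVec] at this
      simpa [quadForm] using this
    obtain ⟨c, y, hy, hXy⟩ := exists_eq_smul_vecMulVec_of_card_le_four hX hu hC
      (eq_blockRestrict_of_closed hX hu hiC hi fun a ha b hb => by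
        have := hcl a ha b hb
        rw [IsLight] at this
        push Not at this
        obtain ⟨k, hk⟩ := this
        rw [hZ.apply a b, and_self]
        exact (hdiag k).trans hk)
    exact exact_of_eq_smul_vecMulVec hX hu hy hXy
  · exact absurd ⟨v, hv, hr⟩ hgood

/-! ### Almost sure uniqueness of the optimizer -/

/-- The index set of the entries on and above the diagonal. -/
abbrev UpperIdx (n : ℕ) : Type := {p : Fin n × Fin n // p.1 ≤ p.2}

/-- The symmetric matrix with prescribed entries on and above the diagonal. -/
def symMat {n : ℕ} (z : UpperIdx n → ℝ) : Matrix (Fin n) (Fin n) ℝ :=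
  Matrix.of fun i j => z ⟨(min i j, max i j), min_le_max⟩

lemma symMat_upper {n : ℕ} {Z : Matrix (Fin n) (Fin n) ℝ} (hZ : Z.IsSymm) :
    symMat (fun p : UpperIdx n => Z p.1.1 p.1.2) = Z := by
  ext i j
  rcases le_total i j with h | h
  · simp [symMat, h]
  · simpa [symMat, h] using hZ.apply i j

section Uniqueness

variable {n : ℕ}

lemma isCompact_dnnFeasible (n : ℕ) : IsCompact (dnnFeasible n) := by
  have hclosed : IsClosed (dnnFeasible n) := by
    have h1 : IsClosed {Y : Matrix (Fin n) (Fin n) ℝ | frob (allOnes n) Y = 1} := by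
      refine isClosed_eq ?_ continuous_const
      unfold frob
      fun_prop
    have h2 : IsClosed {Y : Matrix (Fin n) (Fin n) ℝ | Y.PosSemidef} := by
      have : {Y : Matrix (Fin n) (Fin n) ℝ | Y.PosSemidef} =
          {Y | Yᴴ = Y} ∩ ⋂ x : Fin n → ℝ, {Y | 0 ≤ x ⬝ᵥ (Y *ᵥ x)} := by
        ext Y
        simp [Matrix.posSemidef_iff_dotProduct_mulVec, Matrix.IsHermitian]
      rw [this]
      refine (isClosed_eq (by fun_prop) continuous_id).inter (isClosed_iInter fun x => ?_)
      exact isClosed_le continuous_const (by fun_prop)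
    have h3 : IsClosed {Y : Matrix (Fin n) (Fin n) ℝ | ∀ i j, 0 ≤ Y i j} := by
      simp only [Set.ofPred_forall]
      exact isClosed_iInter fun i => isClosed_iInter fun j =>
        isClosed_le continuous_const (by fun_prop)
    exact h1.inter (h2.inter h3)
  have hK : IsCompact (Set.univ.pi fun _ : Fin n => Set.univ.pi fun _ : Fin n =>
      Set.Icc (0 : ℝ) 1) :=
    isCompact_univ_pi fun _ => isCompact_univ_pi fun _ => isCompact_Icc
  refine hK.of_isClosed_subset hclosed ?_
  intro Y hY i _ j _
  refine ⟨hY.2.2 i j, ?_⟩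
  have h : ∑ i, ∑ j, Y i j = 1 := (frob_allOnes Y).symm.trans hY.1
  rw [← h]
  exact (Finset.single_le_sum (f := fun j => Y i j) (fun j _ => hY.2.2 i j)
    (Finset.mem_univ j)).trans (Finset.single_le_sum (f := fun i => ∑ j, Y i j)
      (fun i _ => Finset.sum_nonneg fun j _ => hY.2.2 i j) (Finset.mem_univ i))

lemma exists_isDNNOptimizer (hn : 1 ≤ n) (Z : Matrix (Fin n) (Fin n) ℝ) :
    ∃ X, IsDNNOptimizer Z X := by
  have hne : (dnnFeasible n).Nonempty :=
    ⟨_, vecMulVec_mem_dnnFeasible (single_mem_stdSimplex ℝ (⟨0, hn⟩ : Fin n))⟩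
  have hc : Continuous (frob Z) := by
    unfold frob
    fun_prop
  obtain ⟨X, hX, hmin⟩ := (isCompact_dnnFeasible n).exists_isMinOn hne hc.continuousOn
  exact ⟨X, hX, hmin⟩

lemma dnnValue_le (hn : 1 ≤ n) (Z : Matrix (Fin n) (Fin n) ℝ) {Y : Matrix (Fin n) (Fin n) ℝ}
    (hY : Y ∈ dnnFeasible n) : dnnValue Z ≤ frob Z Y := by
  obtain ⟨X, hX⟩ := exists_isDNNOptimizer hn Z
  rw [hX.dnnValue_eq]
  exact hX.2 hY

/-- For a fixed matrix `Y`, the objective as a linear function of the upper triangular entries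
of the data. -/
def frobLin (Y : Matrix (Fin n) (Fin n) ℝ) : (UpperIdx n → ℝ) →ₗ[ℝ] ℝ where
  toFun z := frob (symMat z) Y
  map_add' z w := by
    simp [frob, symMat, add_mul, Finset.sum_add_distrib]
  map_smul' c z := by
    simp only [frob, symMat, Matrix.of_apply, Pi.smul_apply, smul_eq_mul, Finset.mul_sum,
      RingHom.id_apply, mul_assoc]

lemma frobLin_apply (Y : Matrix (Fin n) (Fin n) ℝ) (z : UpperIdx n → ℝ) :
    frobLin Y z = frob (symMat z) Y := rfl

lemma frobLin_le_dist {Y : Matrix (Fin n) (Fin n) ℝ} (hY : Y ∈ dnnFeasible n)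
    (z w : UpperIdx n → ℝ) : frobLin Y z ≤ frobLin Y w + dist z w := by
  have h : dist z w = ∑ i, ∑ j, dist z w * Y i j := by
    simp_rw [← Finset.mul_sum]
    rw [← frob_allOnes, hY.1, mul_one]
  rw [h, frobLin_apply, frobLin_apply, frob, frob, ← Finset.sum_add_distrib]
  refine Finset.sum_le_sum fun i _ => ?_
  rw [← Finset.sum_add_distrib]
  refine Finset.sum_le_sum fun j _ => ?_
  rw [← add_mul]
  refine mul_le_mul_of_nonneg_right ?_ (hY.2.2 i j)
  have := (le_abs_self _).trans (dist_le_pi_dist z w ⟨(min i j, max i j), min_le_max⟩)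
  simp only [symMat, Matrix.of_apply]
  linarith

lemma lipschitzWith_dnnValue (hn : 1 ≤ n) :
    LipschitzWith 1 fun z : UpperIdx n → ℝ => dnnValue (symMat z) := by
  refine LipschitzWith.of_le_add fun z w => ?_
  obtain ⟨X, hX⟩ := exists_isDNNOptimizer hn (symMat w)
  rw [hX.dnnValue_eq]
  exact (dnnValue_le hn _ hX.1).trans (frobLin_le_dist hX.1 z w)

/-- A positive semidefinite matrix is determined by the objective it induces on symmetric data. -/
lemma eq_of_frobLin_eq {Y Y' : Matrix (Fin n) (Fin n) ℝ} (hY : IsDNN Y) (hY' : IsDNN Y')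
    (h : frobLin Y = frobLin Y') : Y = Y' := by
  have key : ∀ i j, i ≤ j → Y i j = Y' i j := by
    intro i j hij
    have hsum : ∀ W : Matrix (Fin n) (Fin n) ℝ, IsDNN W →
        frobLin W (Pi.single ⟨(i, j), hij⟩ 1) = (if i = j then 1 else 2) * W i j := by
      intro W hW
      have hent : ∀ a b : Fin n,
          symMat (Pi.single (⟨(i, j), hij⟩ : UpperIdx n) (1 : ℝ)) a b =
          (if a = i ∧ b = j then 1 else 0) + (if a = j ∧ b = i then 1 else 0)
            - (if i = j ∧ a = i ∧ b = j then 1 else 0) := by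
        intro a b
        simp only [symMat, Matrix.of_apply, Pi.single_apply, Subtype.mk.injEq, Prod.mk.injEq]
        grind
      rw [frobLin_apply, frob]
      simp only [hent, sub_mul, add_mul, ite_mul, one_mul, zero_mul, Finset.sum_sub_distrib,
        Finset.sum_add_distrib, ite_and]
      rcases eq_or_ne i j with rfl | hne
      · simp
      · simp [hne, hW.symm_apply j i]
        ring
    have := LinearMap.congr_fun h (Pi.single ⟨(i, j), hij⟩ 1)
    rw [hsum Y hY, hsum Y' hY'] at this
    refine mul_left_cancel₀ ?_ this
    split_ifs <;> norm_num
  ext i j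
  rcases le_total i j with hij | hij
  · exact key i j hij
  · rw [hY.symm_apply, hY'.symm_apply, key j i hij]

/-- Where the optimal value is differentiable, its derivative is the objective of every
optimizer; hence the optimizer is unique. -/
lemma unique_of_differentiableAt (hn : 1 ≤ n) {z : UpperIdx n → ℝ}
    (hz : DifferentiableAt ℝ (fun z : UpperIdx n → ℝ => dnnValue (symMat z)) z)
    {Y Y' : Matrix (Fin n) (Fin n) ℝ} (hY : IsDNNOptimizer (symMat z) Y)
    (hY' : IsDNNOptimizer (symMat z) Y') : Y = Y' := by
  have key : ∀ {W : Matrix (Fin n) (Fin n) ℝ}, IsDNNOptimizer (symMat z) W →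
      fderiv ℝ (fun z : UpperIdx n → ℝ => dnnValue (symMat z)) z
        = (frobLin W).toContinuousLinearMap := by
    intro W hW
    set L := (frobLin W).toContinuousLinearMap
    have hL : ∀ w, L w = frob (symMat w) W := fun _ => rfl
    have hmax : IsLocalMax ((fun z : UpperIdx n → ℝ => dnnValue (symMat z)) - ⇑L) z := by
      refine Filter.Eventually.of_forall fun w => ?_
      simp only [Pi.sub_apply, hL, hW.dnnValue_eq, sub_self]
      exact sub_nonpos.2 (dnnValue_le hn _ hW.1)
    have h0 := hmax.fderiv_eq_zero
    rw [fderiv_sub hz L.differentiableAt, L.fderiv] at h0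
    exact sub_eq_zero.1 h0
  refine eq_of_frobLin_eq hY.1.2 hY'.1.2 ?_
  have h := (key hY).symm.trans (key hY')
  exact LinearMap.toContinuousLinearMap.injective h

/-- Finite products preserve absolute continuity. -/
lemma pi_absolutelyContinuous {m : ℕ} (μ ν : Fin m → Measure ℝ) [∀ i, SigmaFinite (μ i)]
    [∀ i, SigmaFinite (ν i)] (h : ∀ i, μ i ≪ ν i) : Measure.pi μ ≪ Measure.pi ν := by
  induction m with
  | zero =>
    rw [Measure.pi_of_empty, Measure.pi_of_empty]
  | succ m ih =>
    have hμ := (measurePreserving_piFinSuccAbove μ 0).symm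
    have hν := (measurePreserving_piFinSuccAbove ν 0).symm
    rw [← hμ.map_eq, ← hν.map_eq]
    exact ((h 0).prod (ih _ _ fun i => h _)).map (MeasurableEquiv.measurable _)

lemma pi_gaussian_absolutelyContinuous {ι : Type*} [Fintype ι] {v : ι → ℝ≥0} (hv : ∀ i, v i ≠ 0) :
    Measure.pi (fun i => gaussianReal 0 (v i)) ≪ (volume : Measure (ι → ℝ)) := by
  let e := (Fintype.equivFin ι).symm
  have h1 := measurePreserving_piCongrLeft (fun i => gaussianReal 0 (v i)) e
  have h2 := measurePreserving_piCongrLeft (fun _ : ι => (volume : Measure ℝ)) e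
  rw [volume_pi, ← h1.map_eq, ← h2.map_eq]
  exact (pi_absolutelyContinuous _ _ fun i =>
    gaussianReal_absolutelyContinuous 0 (hv _)).map (MeasurableEquiv.measurable _)

end Uniqueness

lemma IsGOE.hasLaw {Ω : Type*} [MeasurableSpace Ω] {P : Measure Ω} {n : ℕ}
    {Q : Ω → Matrix (Fin n) (Fin n) ℝ} (hQ : IsGOE P Q) (p : UpperIdx n) :
    HasLaw (fun ω => Q ω p.1.1 p.1.2) (gaussianReal 0 (if p.1.1 = p.1.2 then 1 else 1 / 2)) P := by
  obtain ⟨⟨i, j⟩, hij⟩ := p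
  rcases eq_or_lt_of_le hij with h | h
  · obtain rfl : i = j := h
    simpa using hQ.diag i
  · have : i ≠ j := ne_of_lt h
    simpa [this] using hQ.offDiag i j h

/-- Almost surely the relaxation of a GOE matrix has exactly one optimizer: the optimal value is
a Lipschitz function of the upper triangular entries, whose law is absolutely continuous, so
Rademacher's theorem applies. -/
theorem IsGOE.ae_unique {Ω : Type*} [MeasurableSpace Ω] {P : Measure Ω} [IsProbabilityMeasure P]
    {n : ℕ} (hn : 1 ≤ n) {Q : Ω → Matrix (Fin n) (Fin n) ℝ} (hQ : IsGOE P Q) :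
    ∀ᵐ ω ∂P, ∃ X, IsDNNOptimizer (Q ω) X ∧ ∀ X', IsDNNOptimizer (Q ω) X' → X' = X := by
  have hdiff := (lipschitzWith_dnnValue hn).ae_differentiableAt (μ := volume)
  have hae : ∀ p : UpperIdx n, AEMeasurable (fun ω => Q ω p.1.1 p.1.2) P :=
    fun p => (hQ.hasLaw p).aemeasurable
  have hmap : P.map (fun ω (p : UpperIdx n) => Q ω p.1.1 p.1.2) ≪
      (volume : Measure (UpperIdx n → ℝ)) := by
    rw [hQ.indep.map_fun_eq_pi_map hae]
    simp_rw [fun p => (hQ.hasLaw p).map_eq]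
    refine pi_gaussian_absolutelyContinuous fun p => ?_
    split_ifs
    exacts [one_ne_zero, by norm_num]
  have h := ae_of_ae_map (aemeasurable_pi_lambda _ hae) (hmap.ae_le hdiff)
  filter_upwards [h, hQ.symm] with ω hω hs
  obtain ⟨X, hX⟩ := exists_isDNNOptimizer hn (Q ω)
  refine ⟨X, hX, fun X' hX' => ?_⟩
  rw [← symMat_upper hs] at hX hX'
  exact unique_of_differentiableAt hn hω hX' hX

/-! ### Gaussian tails -/

lemma gaussianReal_real_eq_setIntegral {v : ℝ≥0} (hv : v ≠ 0) (s : Set ℝ) :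
    (gaussianReal 0 v).real s = ∫ x in s, gaussianPDFReal 0 v x := by
  rw [Measure.real, gaussianReal_apply_eq_integral 0 hv, ENNReal.toReal_ofReal]
  exact integral_nonneg fun x => gaussianPDFReal_nonneg 0 v x

/-- Lower bound for the tail of the standard Gaussian, from an interval of length `1 / t`. -/
lemma exists_le_gaussian_tail : ∃ c : ℝ, 0 < c ∧ ∀ t : ℝ, 1 ≤ t →
    c * Real.exp (-t ^ 2 / 2) / t ≤ (gaussianReal 0 1).real (Set.Iic (-t)) := by
  refine ⟨(√(2 * Real.pi))⁻¹ * Real.exp (-(3 / 2)), by positivity, fun t ht => ?_⟩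
  have ht0 : 0 < t := by linarith
  have h1 : (gaussianReal 0 1).real (Set.Icc (-t - 1 / t) (-t)) ≤
      (gaussianReal 0 1).real (Set.Iic (-t)) := measureReal_mono Set.Icc_subset_Iic_self
  refine le_trans ?_ h1
  rw [gaussianReal_real_eq_setIntegral one_ne_zero]
  have h2 : ∀ x ∈ Set.Icc (-t - 1 / t) (-t),
      (√(2 * Real.pi))⁻¹ * Real.exp (-(3 / 2)) * Real.exp (-t ^ 2 / 2)
        ≤ gaussianPDFReal 0 1 x := by
    intro x hx
    rw [gaussianPDFReal, mul_assoc, ← Real.exp_add]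
    simp only [NNReal.coe_one, mul_one, sub_zero]
    refine mul_le_mul_of_nonneg_left (Real.exp_le_exp.2 ?_) (by positivity)
    have hinv : 1 / t ≤ 1 := by rw [div_le_one ht0]; exact ht
    have hmul : t * (1 / t) = 1 := by field_simp
    have hpos : 0 < 1 / t := by positivity
    have h3 : x ^ 2 ≤ (t + 1 / t) ^ 2 := by
      rw [sq_le_sq, abs_of_nonpos (by linarith [hx.2]), abs_of_pos (by positivity)]
      linarith [hx.1]
    nlinarith
  have h3 := setIntegral_ge_of_const_le_real measurableSet_Icc
    (by rw [Real.volume_Icc]; exact ENNReal.ofReal_ne_top) h2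
    (integrable_gaussianPDFReal 0 1).integrableOn
  refine le_trans (le_of_eq ?_) h3
  rw [Real.volume_real_Icc, max_eq_left (by have : 0 < 1 / t := by positivity
                                            linarith)]
  ring

lemma gaussian_half_tail_le {t : ℝ} (ht : 1 ≤ t) :
    (gaussianReal 0 (1 / 2)).real (Set.Iic (-t)) ≤ Real.exp (-t ^ 2) / t := by
  have ht0 : 0 < t := by linarith
  rw [gaussianReal_real_eq_setIntegral (by norm_num)]
  have h2 : ∀ x ∈ Set.Iic (-t), gaussianPDFReal 0 (1 / 2) x ≤
      Real.exp (t ^ 2) * Real.exp (2 * t * x) := by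
    intro x hx
    rw [gaussianPDFReal, ← Real.exp_add]
    have h3 : (√(2 * Real.pi * ((1 / 2 : ℝ≥0) : ℝ)))⁻¹ ≤ 1 := by
      refine inv_le_one_of_one_le₀ (Real.one_le_sqrt.2 ?_)
      push_cast
      linarith [Real.pi_gt_three]
    have h4 : -(x - 0) ^ 2 / (2 * ((1 / 2 : ℝ≥0) : ℝ)) ≤ t ^ 2 + 2 * t * x := by
      push_cast
      nlinarith [sq_nonneg (x + t)]
    calc _ ≤ 1 * Real.exp (t ^ 2 + 2 * t * x) :=
          mul_le_mul h3 (Real.exp_le_exp.2 h4) (Real.exp_pos _).le zero_le_one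
      _ = _ := one_mul _
  have hint : IntegrableOn (fun x => Real.exp (t ^ 2) * Real.exp (2 * t * x)) (Set.Iic (-t)) :=
    (integrableOn_exp_mul_Iic (by positivity) _).const_mul _
  refine (setIntegral_mono_on (integrable_gaussianPDFReal 0 _).integrableOn hint
    measurableSet_Iic h2).trans ?_
  rw [integral_const_mul, integral_exp_mul_Iic (by positivity), ← mul_div_assoc, ← Real.exp_add]
  have : t ^ 2 + 2 * t * -t = -t ^ 2 := by ring
  rw [this]
  exact div_le_div_of_nonneg_left (Real.exp_pos _).le ht0 (by linarith)

/-- Comparison of the two Gaussian distribution functions: up to a factor linear in the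
threshold, the one of variance `1 / 2` is the square of the one of variance `1`. -/
lemma exists_gaussian_half_le_sq : ∃ C : ℝ, 1 ≤ C ∧ ∀ T b : ℝ, 1 ≤ T → -T ≤ b →
    (gaussianReal 0 (1 / 2)).real (Set.Iic b) ≤
      C * T * (gaussianReal 0 1).real (Set.Iic b) ^ 2 := by
  obtain ⟨c, hc, hlow⟩ := exists_le_gaussian_tail
  set p := (gaussianReal 0 1).real (Set.Iic (-1)) with hp
  have hp0 : 0 < p := lt_of_lt_of_le (by positivity) (hlow 1 le_rfl)
  refine ⟨max 1 (max (1 / c ^ 2) (1 / p ^ 2)), le_max_left _ _, fun T b hT hb => ?_⟩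
  set C := max 1 (max (1 / c ^ 2) (1 / p ^ 2)) with hC
  have hC1 : 1 ≤ C * c ^ 2 := by
    rw [← div_le_iff₀ (by positivity)]
    exact (le_max_left _ _).trans (le_max_right _ _)
  have hC2 : 1 ≤ C * p ^ 2 := by
    rw [← div_le_iff₀ (by positivity)]
    exact (le_max_right _ _).trans (le_max_right _ _)
  have hC0 : 0 < C := lt_of_lt_of_le one_pos (le_max_left _ _)
  rcases le_total b (-1) with hb1 | hb1
  · obtain ⟨t, rfl⟩ : ∃ t, b = -t := ⟨-b, by ring⟩
    have ht : 1 ≤ t := by linarith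
    have ht0 : 0 < t := by linarith
    have h1 := hlow t ht
    have h2 : (c * Real.exp (-t ^ 2 / 2) / t) ^ 2 ≤
        (gaussianReal 0 1).real (Set.Iic (-t)) ^ 2 := pow_le_pow_left₀ (by positivity) h1 2
    have h3 : (c * Real.exp (-t ^ 2 / 2) / t) ^ 2 = c ^ 2 * (Real.exp (-t ^ 2) / t ^ 2) := by
      rw [div_pow, mul_pow, ← Real.exp_nat_mul]
      rw [show ((2 : ℕ) : ℝ) * (-t ^ 2 / 2) = -t ^ 2 by push_cast; ring]
      ring
    calc _ ≤ Real.exp (-t ^ 2) / t := gaussian_half_tail_le ht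
      _ = t * (Real.exp (-t ^ 2) / t ^ 2) := by field_simp
      _ ≤ T * (Real.exp (-t ^ 2) / t ^ 2) :=
        mul_le_mul_of_nonneg_right (by linarith) (by positivity)
      _ ≤ (C * c ^ 2) * (T * (Real.exp (-t ^ 2) / t ^ 2)) :=
        le_mul_of_one_le_left (by positivity) hC1
      _ = C * T * (c ^ 2 * (Real.exp (-t ^ 2) / t ^ 2)) := by ring
      _ ≤ _ := by
        rw [← h3]
        exact mul_le_mul_of_nonneg_left h2 (by positivity)
  · have h1 : p ≤ (gaussianReal 0 1).real (Set.Iic b) :=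
      measureReal_mono (Set.Iic_subset_Iic.2 hb1)
    calc _ ≤ (1 : ℝ) := measureReal_le_one
      _ ≤ C * p ^ 2 := hC2
      _ ≤ (C * p ^ 2) * T := le_mul_of_one_le_right (by positivity) hT
      _ = C * T * p ^ 2 := by ring
      _ ≤ _ := mul_le_mul_of_nonneg_left (pow_le_pow_left₀ hp0.le h1 2) (by positivity)

/-- The standard Gaussian distribution function. -/
noncomputable def gaussCDF (x : ℝ) : ℝ := (gaussianReal 0 1).real (Set.Iic x)

lemma gaussCDF_nonneg (x : ℝ) : 0 ≤ gaussCDF x := measureReal_nonneg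

lemma gaussCDF_strictMono : StrictMono gaussCDF := by
  intro a b hab
  have h : gaussCDF b = gaussCDF a + (gaussianReal 0 1).real (Set.Ioc a b) := by
    rw [gaussCDF, gaussCDF, ← measureReal_union _ measurableSet_Ioc, Set.Iic_union_Ioc_eq_Iic hab.le]
    rw [Set.disjoint_left]
    intro x hx hx'
    exact absurd hx'.1 (not_lt.2 hx)
  rw [h, lt_add_iff_pos_right]
  refine measureReal_nonneg.lt_of_ne' fun h0 => ?_
  rw [measureReal_eq_zero_iff] at h0
  have := gaussianReal_absolutelyContinuous' 0 one_ne_zero h0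
  rw [Real.volume_Ioc] at this
  simp at this
  linarith

lemma gaussCDF_lt_one (x : ℝ) : gaussCDF x < 1 :=
  (gaussCDF_strictMono (lt_add_one x)).trans_le measureReal_le_one

lemma exists_gaussCDF_eq {s : ℝ} (h0 : 0 < s) (h1 : s < 1) : ∃ q, gaussCDF q = s := by
  have hfun : gaussCDF = cdf (gaussianReal 0 1) := by
    funext x
    rw [cdf_eq_real, gaussCDF]
  have hcont : Continuous gaussCDF := by
    have : NullSingletonClass (gaussianReal 0 1) := nullSingletonClass_gaussianReal one_ne_zero
    have hprim := intervalIntegral.continuous_primitive (μ := gaussianReal 0 1)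
      (f := fun _ => (1 : ℝ)) (fun a b => intervalIntegrable_const) 0
    have heq : gaussCDF = fun x => gaussCDF 0 + ∫ _ in (0 : ℝ)..x, (1 : ℝ) ∂(gaussianReal 0 1) := by
      funext x
      rw [← intervalIntegral.integral_Iic_sub_Iic (integrable_const _).integrableOn
        (integrable_const _).integrableOn]
      simp [gaussCDF]
    rw [heq]
    exact continuous_const.add hprim
  have hbot : ∃ a, gaussCDF a < s := by
    rw [hfun]
    exact ((tendsto_cdf_atBot _).eventually_lt_const h0).exists
  have htop : ∃ b, s < gaussCDF b := by
    rw [hfun]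
    exact ((tendsto_cdf_atTop _).eventually_const_lt h1).exists
  obtain ⟨a, ha⟩ := hbot
  obtain ⟨b, hb⟩ := htop
  exact mem_range_of_exists_le_of_exists_ge hcont ⟨a, ha.le⟩ ⟨b, hb.le⟩

lemma measurable_gaussCDF : Measurable gaussCDF := gaussCDF_strictMono.monotone.measurable

lemma gaussian_real_le_gaussCDF {s : ℝ} (h0 : 0 ≤ s) (h1 : s < 1) :
    (gaussianReal 0 1).real {x | s ≤ gaussCDF x} ≤ 1 - s := by
  rcases h0.eq_or_lt with rfl | h0
  · rw [sub_zero]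
    exact measureReal_le_one
  obtain ⟨q, rfl⟩ := exists_gaussCDF_eq h0 h1
  have : NullSingletonClass (gaussianReal 0 1) := nullSingletonClass_gaussianReal one_ne_zero
  have hset : {x | gaussCDF q ≤ gaussCDF x} = Set.Ici q := by
    ext x
    exact gaussCDF_strictMono.le_iff_le
  have hcompl := probReal_compl_eq_one_sub (μ := gaussianReal 0 1) (measurableSet_Iic (a := q))
  rw [Set.compl_Iic] at hcompl
  rw [hset, gaussCDF, ← hcompl, measureReal_congr Ioi_ae_eq_Ici]

lemma exists_gaussian_half_lt_le : ∃ C : ℝ, 1 ≤ C ∧ ∀ T s : ℝ, 1 ≤ T → 0 < s → s ≤ 1 →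
    (gaussianReal 0 (1 / 2)).real {x | gaussCDF (max x (-T)) < s} ≤ C * T * s ^ 2 := by
  obtain ⟨C, hC, h⟩ := exists_gaussian_half_le_sq
  refine ⟨C, hC, fun T s hT h0 h1 => ?_⟩
  rcases h1.eq_or_lt with rfl | h1
  · rw [one_pow, mul_one]
    exact measureReal_le_one.trans (one_le_mul_of_one_le_of_one_le hC hT)
  obtain ⟨q, rfl⟩ := exists_gaussCDF_eq h0 h1
  rcases le_total q (-T) with hq | hq
  · have : {x | gaussCDF (max x (-T)) < gaussCDF q} = ∅ := by
      ext x
      simpa using gaussCDF_strictMono.monotone (hq.trans (le_max_right x (-T)))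
    rw [this, measureReal_empty]
    positivity
  · refine (measureReal_mono fun x hx => ?_).trans (h T q hT hq)
    exact (le_max_left x (-T)).trans (gaussCDF_strictMono.lt_iff_lt.1 hx).le

/-! ### Probability of light pairs -/

section Light

variable {Ω : Type*} [MeasurableSpace Ω] {P : Measure Ω} {n : ℕ}
  {Q : Ω → Matrix (Fin n) (Fin n) ℝ}

lemma IsGOE.measureReal_offDiag_diag (hQ : IsGOE P Q) {m : ℕ} {e : Fin m → UpperIdx n}
    (he : e.Injective) (hoff : ∀ k, (e k).1.1 ≠ (e k).1.2) {B D : Set ℝ}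
    (hB : MeasurableSet B) (hD : MeasurableSet D) :
    P.real {ω | (∀ k, Q ω (e k).1.1 (e k).1.2 ∈ B) ∧ ∀ i, Q ω i i ∈ D} =
      (gaussianReal 0 (1 / 2)).real B ^ m * (gaussianReal 0 1).real D ^ n := by
  classical
  let d : Fin n → UpperIdx n := fun i => ⟨(i, i), le_rfl⟩
  have hd : d.Injective := fun i j h => congrArg (fun p : UpperIdx n => p.1.1) h
  let sets : UpperIdx n → Set ℝ := fun p => if p.1.1 = p.1.2 then D else B
  have hmeas : ∀ p, MeasurableSet (sets p) := by
    intro p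
    simp only [sets]
    split_ifs
    exacts [hD, hB]
  have hdisj : Disjoint (Finset.univ.image e) (Finset.univ.image d) := by
    rw [Finset.disjoint_left]
    intro p hp hp'
    obtain ⟨k, -, rfl⟩ := Finset.mem_image.1 hp
    obtain ⟨i, -, hi⟩ := Finset.mem_image.1 hp'
    exact hoff k (by rw [← hi])
  have hprod := hQ.indep.measure_inter_preimage_eq_mul
    (Finset.univ.image e ∪ Finset.univ.image d) (sets := sets) (fun p _ => hmeas p)
  have hset : {ω | (∀ k, Q ω (e k).1.1 (e k).1.2 ∈ B) ∧ ∀ i, Q ω i i ∈ D} =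
      ⋂ p ∈ Finset.univ.image e ∪ Finset.univ.image d,
        (fun ω => Q ω p.1.1 p.1.2) ⁻¹' sets p := by
    ext ω
    simp only [Set.mem_ofPred_eq, Set.mem_iInter, Finset.mem_union, Finset.mem_image,
      Finset.mem_univ, true_and, Set.mem_preimage]
    constructor
    · rintro ⟨h1, h2⟩ p (⟨k, rfl⟩ | ⟨i, rfl⟩)
      · simpa [sets, hoff k] using h1 k
      · simpa [sets, d] using h2 i
    · intro h
      refine ⟨fun k => ?_, fun i => ?_⟩
      · simpa [sets, hoff k] using h (e k) (Or.inl ⟨k, rfl⟩)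
      · simpa [sets, d] using h (d i) (Or.inr ⟨i, rfl⟩)
  rw [hset, Measure.real, hprod, ENNReal.toReal_prod, Finset.prod_union hdisj,
    Finset.prod_image he.injOn, Finset.prod_image hd.injOn]
  have h1 : ∀ k, (P ((fun ω => Q ω (e k).1.1 (e k).1.2) ⁻¹' sets (e k))).toReal =
      (gaussianReal 0 (1 / 2)).real B := by
    intro k
    have hl := hQ.hasLaw (e k)
    rw [if_neg (hoff k)] at hl
    rw [Measure.real, ← hl.map_eq, Measure.map_apply_of_aemeasurable hl.aemeasurable hB]
    simp [sets, hoff k]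
  have h2 : ∀ i, (P ((fun ω => Q ω (d i).1.1 (d i).1.2) ⁻¹' sets (d i))).toReal =
      (gaussianReal 0 1).real D := by
    intro i
    have hl := hQ.diag i
    rw [Measure.real, ← hl.map_eq, Measure.map_apply_of_aemeasurable hl.aemeasurable hD]
    simp [sets, d]
  simp only [h1, h2, Finset.prod_const, Finset.card_univ, Fintype.card_fin]

lemma summable_succ_pow_mul_exp_neg (r : ℕ) :
    Summable fun k : ℕ => ((k : ℝ) + 1) ^ r * Real.exp (-k) := by
  have h := ((summable_nat_add_iff 1).2
    (Real.summable_pow_mul_exp_neg_nat_mul r one_pos)).mul_left (Real.exp 1)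
  refine h.congr fun k => ?_
  push_cast
  rw [mul_left_comm, ← Real.exp_add]
  congr 2
  ring

end Light

/-- Four given off-diagonal entries are all smaller than the whole diagonal with probability
`O((log n)² / n⁸)`. Write `Φ` for the standard Gaussian distribution function. The smallest
diagonal entry satisfies `Φ ≥ k / n` with probability at most `e⁻ᵏ`, and an off-diagonal entry
satisfies `Φ < (k + 1) / n` with probability `O(T ((k + 1) / n)²)` as long as the threshold stays
above `-T`, where `T = √(2 log n)`; summing over `k` costs only a constant. -/
theorem IsGOE.exists_light_bound : ∃ K : ℝ, 0 ≤ K ∧ ∀ (n : ℕ), 2 ≤ n →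
    ∀ (Ω : Type*) [MeasurableSpace Ω] (P : Measure Ω) [IsProbabilityMeasure P]
      (Q : Ω → Matrix (Fin n) (Fin n) ℝ), IsGOE P Q →
      ∀ e : Fin 4 → UpperIdx n, e.Injective → (∀ k, (e k).1.1 ≠ (e k).1.2) →
        P.real {ω | ∀ k, IsLight (Q ω) (e k).1.1 (e k).1.2} ≤
          K * Real.log n ^ 2 / (n : ℝ) ^ 8 := by
  obtain ⟨C, hC, hlt⟩ := exists_gaussian_half_lt_le
  have hsum := summable_succ_pow_mul_exp_neg 8
  set S := ∑' k : ℕ, ((k : ℝ) + 1) ^ 8 * Real.exp (-k) with hS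
  have hS0 : 0 ≤ S := tsum_nonneg fun k => by positivity
  refine ⟨4 * (1 + C ^ 4 * S), by positivity, fun n hn Ω _ P _ Q hQ e he hoff => ?_⟩
  have hn0 : (0 : ℝ) < n := by positivity
  have hn2 : (2 : ℝ) ≤ n := by exact_mod_cast hn
  set L := Real.log n with hL
  have hL2 : 1 / 2 ≤ L := by
    have h1 := Real.log_le_log two_pos hn2
    linarith [Real.log_two_gt_d9]
  set T := √(2 * L) with hT
  have hT1 : 1 ≤ T := Real.one_le_sqrt.2 (by linarith)
  have hTsq : T ^ 2 = 2 * L := Real.sq_sqrt (by linarith)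
  let E : Set ℝ → Set ℝ → Set Ω := fun B D =>
    {ω | (∀ k, Q ω (e k).1.1 (e k).1.2 ∈ B) ∧ ∀ i, Q ω i i ∈ D}
  let B : ℕ → Set ℝ := fun k => {x | gaussCDF (max x (-T)) < ((k : ℝ) + 1) / n}
  let D : ℕ → Set ℝ := fun k => {x | (k : ℝ) / n ≤ gaussCDF x}
  have hBm : ∀ k, MeasurableSet (B k) := fun k =>
    measurableSet_lt (measurable_gaussCDF.comp (measurable_id.max measurable_const))
      measurable_const
  have hDm : ∀ k, MeasurableSet (D k) := fun k =>
    measurableSet_le measurable_const measurable_gaussCDF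
  have hcover : {ω | ∀ k, IsLight (Q ω) (e k).1.1 (e k).1.2} ⊆
      E (Set.Iic (-T)) Set.univ ∪ ⋃ k ∈ Finset.range n, E (B k) (D k) := by
    intro ω hω
    obtain ⟨i₀, -, hi₀⟩ := Finset.exists_min_image Finset.univ (fun i => Q ω i i)
      ⟨⟨0, by omega⟩, Finset.mem_univ _⟩
    set m := Q ω i₀ i₀
    rcases le_or_gt m (-T) with hm | hm
    · exact Or.inl ⟨fun k => ((hω k i₀).le.trans hm), fun i => Set.mem_univ _⟩
    · right
      -- `k / n ≤ Φ m < (k + 1) / n` for the minimum `m` of the diagonal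
      have hfl := Nat.floor_le (mul_nonneg hn0.le (gaussCDF_nonneg m))
      have hfl' := Nat.lt_floor_add_one ((n : ℝ) * gaussCDF m)
      set k := ⌊(n : ℝ) * gaussCDF m⌋₊
      simp only [Set.mem_iUnion]
      refine ⟨k, ?_, fun l => ?_, fun i => ?_⟩
      · rw [Finset.mem_range]
        have : (k : ℝ) < n := hfl.trans_lt (mul_lt_of_lt_one_right hn0 (gaussCDF_lt_one m))
        exact_mod_cast this
      · have h1 : max (Q ω (e l).1.1 (e l).1.2) (-T) ≤ m := max_le (hω l i₀).le hm.le
        refine (gaussCDF_strictMono.monotone h1).trans_lt ?_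
        rw [lt_div_iff₀ hn0, mul_comm]
        exact hfl'
      · refine le_trans ?_ (gaussCDF_strictMono.monotone (hi₀ i (Finset.mem_univ i)))
        rw [div_le_iff₀ hn0, mul_comm]
        exact hfl
  have hfirst : P.real (E (Set.Iic (-T)) Set.univ) ≤ 1 / (n : ℝ) ^ 8 := by
    rw [hQ.measureReal_offDiag_diag he hoff measurableSet_Iic MeasurableSet.univ]
    rw [probReal_univ, one_pow, mul_one]
    have h1 : (gaussianReal 0 (1 / 2)).real (Set.Iic (-T)) ≤ 1 / (n : ℝ) ^ 2 := by
      refine (gaussian_half_tail_le hT1).trans ((div_le_self (Real.exp_pos _).le hT1).trans ?_)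
      rw [hTsq, Real.exp_neg, one_div]
      rw [show 2 * L = ((2 : ℕ) : ℝ) * L by push_cast; ring, Real.exp_nat_mul, hL,
        Real.exp_log hn0]
    refine (pow_le_pow_left₀ measureReal_nonneg h1 4).trans (le_of_eq ?_)
    rw [div_pow, one_pow, ← pow_mul]
  have hk : ∀ k ∈ Finset.range n, P.real (E (B k) (D k)) ≤
      C ^ 4 * T ^ 4 / (n : ℝ) ^ 8 * (((k : ℝ) + 1) ^ 8 * Real.exp (-k)) := by
    intro k hkn
    have hkn' : (k : ℝ) + 1 ≤ n := by exact_mod_cast Finset.mem_range.1 hkn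
    rw [hQ.measureReal_offDiag_diag he hoff (hBm k) (hDm k)]
    have h1 : (gaussianReal 0 (1 / 2)).real (B k) ≤ C * T * (((k : ℝ) + 1) / n) ^ 2 :=
      hlt T _ hT1 (by positivity) ((div_le_one hn0).2 hkn')
    have h2 : (gaussianReal 0 1).real (D k) ≤ Real.exp (-(k / n)) :=
      (gaussian_real_le_gaussCDF (by positivity) ((div_lt_one hn0).2 (by linarith))).trans
        (Real.one_sub_le_exp_neg _)
    have h3 : Real.exp (-((k : ℝ) / n)) ^ n = Real.exp (-k) := by
      rw [← Real.exp_nat_mul]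
      congr 1
      field_simp
    calc _ ≤ (C * T * (((k : ℝ) + 1) / n) ^ 2) ^ 4 * Real.exp (-(k / n)) ^ n :=
          mul_le_mul (pow_le_pow_left₀ measureReal_nonneg h1 4)
            (pow_le_pow_left₀ measureReal_nonneg h2 n) (by positivity) (by positivity)
      _ = _ := by
        rw [h3, div_pow]
        ring
  have hT4 : T ^ 4 = 4 * L ^ 2 := by
    rw [show T ^ 4 = (T ^ 2) ^ 2 by ring, hTsq]
    ring
  calc _ ≤ P.real (E (Set.Iic (-T)) Set.univ) +
        ∑ k ∈ Finset.range n, P.real (E (B k) (D k)) :=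
        (measureReal_mono hcover).trans ((measureReal_union_le _ _).trans
          (add_le_add le_rfl (measureReal_biUnion_finset_le _ _)))
    _ ≤ 1 / (n : ℝ) ^ 8 + C ^ 4 * T ^ 4 / (n : ℝ) ^ 8 * S := by
        refine add_le_add hfirst ((Finset.sum_le_sum hk).trans ?_)
        rw [← Finset.mul_sum]
        exact mul_le_mul_of_nonneg_left
          (hsum.sum_le_tsum _ fun k _ => by positivity) (by positivity)
    _ = (1 + 4 * L ^ 2 * (C ^ 4 * S)) / (n : ℝ) ^ 8 := by
        rw [hT4]
        ring
    _ ≤ _ := by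
        refine div_le_div_of_nonneg_right ?_ (by positivity)
        nlinarith

/-- The probability that some component of the graph of light pairs has five or more vertices. -/
theorem IsGOE.exists_growing_bound : ∃ K : ℝ, 0 ≤ K ∧ ∀ (n : ℕ), 2 ≤ n →
    ∀ (Ω : Type*) [MeasurableSpace Ω] (P : Measure Ω) [IsProbabilityMeasure P]
      (Q : Ω → Matrix (Fin n) (Fin n) ℝ), IsGOE P Q →
        P.real {ω | (Q ω).IsSymm ∧ ∃ v : Fin 5 → Fin n, v.Injective ∧
          ∀ k : Fin 4, ∃ j : Fin 5, j ≤ k.castSucc ∧ IsLight (Q ω) (v j) (v k.succ)} ≤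
          K * Real.log n ^ 2 / (n : ℝ) ^ 3 := by
  classical
  obtain ⟨K, hK, hbound⟩ := IsGOE.exists_light_bound
  refine ⟨625 * K, by positivity, fun n hn Ω _ P _ Q hQ => ?_⟩
  have hn0 : (0 : ℝ) < n := by positivity
  let edge : (Fin 5 → Fin n) → (Fin 4 → Fin 5) → Fin 4 → UpperIdx n := fun v p k =>
    ⟨(min (v (p k)) (v k.succ), max (v (p k)) (v k.succ)), min_le_max⟩
  let G : (Fin 5 → Fin n) × (Fin 4 → Fin 5) → Set Ω := fun q =>
    {ω | (q.1.Injective ∧ ∀ k, q.2 k ≤ k.castSucc) ∧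
      ∀ k, IsLight (Q ω) (edge q.1 q.2 k).1.1 (edge q.1 q.2 k).1.2}
  have hcover : {ω | (Q ω).IsSymm ∧ ∃ v : Fin 5 → Fin n, v.Injective ∧
      ∀ k : Fin 4, ∃ j : Fin 5, j ≤ k.castSucc ∧ IsLight (Q ω) (v j) (v k.succ)} ⊆
      ⋃ q, G q := by
    rintro ω ⟨hs, v, hv, h⟩
    choose p hp hlight using h
    refine Set.mem_iUnion.2 ⟨(v, p), ⟨hv, hp⟩, fun k i => ?_⟩
    have := hlight k i
    simp only [edge]
    rcases le_total (v (p k)) (v k.succ) with hle | hle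
    · rwa [min_eq_left hle, max_eq_right hle]
    · rwa [min_eq_right hle, max_eq_left hle, hs.apply]
  have hG : ∀ q, P.real (G q) ≤ K * Real.log n ^ 2 / (n : ℝ) ^ 8 := by
    rintro ⟨v, p⟩
    by_cases hvp : v.Injective ∧ ∀ k, p k ≤ k.castSucc
    · obtain ⟨hv, hp⟩ := hvp
      have hne : ∀ k, v (p k) ≠ v k.succ := fun k h =>
        (Fin.castSucc_lt_succ.trans_le' (hp k)).ne (hv h)
      refine (measureReal_mono fun ω hω => hω.2).trans
        (hbound n hn Ω P Q hQ (edge v p) ?_ fun k => ?_)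
      · -- the later endpoint determines the edge
        intro k l hkl
        have hk := hp k
        have hl := hp l
        have h1 := congrArg (fun x : UpperIdx n => x.1.1) hkl
        have h2 := congrArg (fun x : UpperIdx n => x.1.2) hkl
        simp only [edge] at h1 h2
        have h3 : (v (p k) = v (p l) ∧ v k.succ = v l.succ) ∨
            (v (p k) = v l.succ ∧ v k.succ = v (p l)) := by
          grind
        rcases h3 with ⟨-, h⟩ | ⟨h, h'⟩
        · exact Fin.succ_injective _ (hv h)
        · have e1 := congrArg Fin.val (hv h)
          have e2 := congrArg Fin.val (hv h')
          rw [Fin.le_def] at hk hl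
          simp only [Fin.val_succ, Fin.val_castSucc] at e1 e2 hk hl
          omega
      · exact (inf_lt_sup.2 (hne k)).ne
    · have : G (v, p) = ∅ := by
        ext ω
        exact ⟨fun h => (hvp h.1).elim, fun h => h.elim⟩
      rw [this, measureReal_empty]
      positivity
  calc _ ≤ ∑ q, P.real (G q) := (measureReal_mono hcover).trans (measureReal_iUnion_fintype_le _)
    _ ≤ ∑ _q : (Fin 5 → Fin n) × (Fin 4 → Fin 5), K * Real.log n ^ 2 / (n : ℝ) ^ 8 :=
        Finset.sum_le_sum fun q _ => hG q
    _ = 625 * K * Real.log n ^ 2 / (n : ℝ) ^ 3 := by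
        rw [Finset.sum_const, Finset.card_univ, Fintype.card_prod, Fintype.card_fun,
          Fintype.card_fun, Fintype.card_fin, Fintype.card_fin, Fintype.card_fin, nsmul_eq_mul]
        push_cast
        field_simp

end StQP

theorem theorem2 :
    ∃ K : ℝ, ∀ (n : ℕ), 1 ≤ n →
      ∀ (Ω : Type*) [MeasurableSpace Ω] (P : Measure Ω) [IsProbabilityMeasure P]
        (Q : Ω → Matrix (Fin n) (Fin n) ℝ), StQP.IsGOE P Q →
        ∃ A : Set Ω, MeasurableSet A ∧
          1 - K * (Real.log n) ^ 2 / (n : ℝ) ^ 3 ≤ P.real A ∧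
          ∀ ω ∈ A,
            StQP.DNNUniqueRankOne (Q ω) ∧
            StQP.DNNExact (Q ω) ∧
            ∃! x : Fin n → ℝ, StQP.IsStQPOptimizer (Q ω) x := by
  obtain ⟨K, hK, hbound⟩ := StQP.IsGOE.exists_growing_bound
  refine ⟨K, fun n hn Ω _ P _ Q hQ => ?_⟩
  set bad : Set Ω := {ω | (Q ω).IsSymm ∧ ∃ v : Fin 5 → Fin n, v.Injective ∧
    ∀ k : Fin 4, ∃ j : Fin 5, j ≤ k.castSucc ∧ StQP.IsLight (Q ω) (v j) (v k.succ)} with hbad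
  set N : Set Ω := {ω | ¬ ((Q ω).IsSymm ∧ ∃ X, StQP.IsDNNOptimizer (Q ω) X ∧
    ∀ X', StQP.IsDNNOptimizer (Q ω) X' → X' = X)} with hN
  have hN0 : P.real N = 0 := by
    rw [measureReal_eq_zero_iff]
    exact hQ.symm.and (hQ.ae_unique hn)
  have hb : P.real bad ≤ K * Real.log n ^ 2 / (n : ℝ) ^ 3 := by
    rcases hn.eq_or_lt with rfl | hn2
    · -- a single index leaves no room for five distinct vertices
      have : bad = ∅ := by
        ext ω
        refine ⟨fun ⟨_, v, hv, _⟩ => ?_, fun h => h.elim⟩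
        exact absurd (hv (Subsingleton.elim (v 0) (v 1))) (by decide)
      rw [this, measureReal_empty]
      positivity
    · exact hbound n hn2 Ω P Q hQ
  refine ⟨(toMeasurable P (N ∪ bad))ᶜ, (measurableSet_toMeasurable _ _).compl, ?_, fun ω hω => ?_⟩
  · rw [probReal_compl_eq_one_sub (measurableSet_toMeasurable _ _), Measure.real,
      measure_toMeasurable, ← Measure.real]
    have := measureReal_union_le (μ := P) N bad
    linarith
  · have h := fun h' => hω (subset_toMeasurable P _ h')
    have hgood : (Q ω).IsSymm ∧ ∃ X, StQP.IsDNNOptimizer (Q ω) X ∧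
        ∀ X', StQP.IsDNNOptimizer (Q ω) X' → X' = X := by
      by_contra hcon
      exact h (Or.inl hcon)
    obtain ⟨hs, X, hX, hu⟩ := hgood
    exact StQP.exact_of_unique_of_no_growing hs hX hu fun hv => h (Or.inr ⟨hs, hv⟩)
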